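/- Let $D_{2m}$ denote the dihedral group of order $2m$, with standard rotation $r$ and reflection $s$. Let $\mathrm{GL}^+(2,\mathbb R)$ be the $\mathrm{Pin}^+$ double cover of $\mathrm{GL}(2,\mathbb R)$, let $\mathrm{GL}^+(2,\mathbb Z)\subset\mathrm{GL}^+(2,\mathbb R)$ be the preimage of $\mathrm{GL}(2,\mathbb Z)$, and let $j\colon\mathrm{GL}^+(2,\mathbb Z)\to\mathrm{GL}^+(2,\mathbb R)$ be the inclusion. Embed $D_{16}$ in $\mathrm{GL}^+(2,\mathbb Z)$ by sending the rotation of order $8$ to a lift $\hat S$ of $S=\begin{pmatrix}0&-1\\1&0\end{pmatrix}$ and the reflection to a lift $\hat R$ of $R=\begin{pmatrix}0&1\\1&0\end{pmatrix}$; explicitly, realizing $\mathrm{GL}^+(2,\mathbb R)$ as the group of pairs of a matrix $A$ and a homeomorphism $\sigma$ of $\mathbb C^\times$ with $\sigma(z)^2=A(z^2)$, where $A$ acts on $\mathbb C=\mathbb R^2$, the lifts are $z\mapsto e^{i\pi/4}z$ and $z\mapsto e^{i\pi/4}\bar z$. Let $i,\tilde\imath\colon D_8\to D_{16}$ be the embeddings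 with $i(r)=\tilde\imath(r)=r^2$, $i(s)=s$, $\tilde\imath(s)=rs$; composed with $D_{16}\hookrightarrow\mathrm{GL}^+(2,\mathbb Z)$ they give two maps $D_8\to\mathrm{GL}^+(2,\mathbb Z)$. For a group $G$ with a distinguished central element $(-1)^F$ of order two (namely $r^2\in D_8$, $r^4\in D_{16}$, and the non-trivial element of the kernel of the double cover for $\mathrm{GL}^+(2,\mathbb Z)$ and $\mathrm{GL}^+(2,\mathbb R)$), a Spin-$G$ structure on a smooth $n$-manifold is a reduction and lift of the structure group of its tangent bundle along $\mathrm{Spin}(n)\times_{\{\pm1\}}G\to\mathrm{SO}(n)\subset\mathrm{GL}(n,\mathbb R)$; a continuous homomorphism $G\to G'$ preserving $(-1)^F$ turns Spin-$G$ structures into Spin-$G'$ structures. Two closed Spin-$G$ $n$-manifolds $M_0$, $M_1$ are bordant if there is a compact Spin-$G$ $(n+1)$-manifold with boundary $M_0\sqcup M_1$ whose Spin-$G$ structure restricts on the boundary to the (stabilized) given ones, the extra direction being the inward normal along $M_0$ and the outward normal along $M_1$. Lemma. Let $M$ be a closed Spin-$D_8$ manifold, and let $M$ and $\widetilde M$ denote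 the two Spin-$\mathrm{GL}^+(2,\mathbb Z)$ structures on $M$ induced by $i$ and $\tilde\imath$. Then $M$ and $\widetilde M$, regarded as Spin-$\mathrm{GL}^+(2,\mathbb R)$ manifolds via $j$, are bordant. -/

import Mathlib

open scoped Manifold ContDiff
open CliffordAlgebra

universe u

namespace SpinTwist

noncomputable section

/-! ## The group `Spin(n)`, its vector representation, and `Spin(n) ⊂ Spin(n+1)` -/

/-- The standard positive definite form `v ↦ ∑ v_i²` on `ℝⁿ`. -/
abbrev stdForm (n : ℕ) : QuadraticForm ℝ (Fin n → ℝ) :=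
  QuadraticMap.weightedSumSquares ℝ (fun _ : Fin n => (1 : ℝ))

/-- The real Clifford algebra of `ℝⁿ`. -/
abbrev Cl (n : ℕ) : Type := CliffordAlgebra (stdForm n)

/-- The canonical topology of the Clifford algebra, a finite-dimensional real vector space. -/
instance (n : ℕ) : TopologicalSpace (Cl n) := moduleTopology ℝ (Cl n)

instance (n : ℕ) : IsModuleTopology ℝ (Cl n) := ⟨rfl⟩

/-- `Spin(n)`, with the topology induced from the Clifford algebra. -/
abbrev Spin (n : ℕ) : Type := spinGroup (stdForm n)

/-- The projection of the Clifford algebra onto the vectors `ℝⁿ`, a left inverse of `ι`. -/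
def vectorPart (n : ℕ) : Cl n →ₗ[ℝ] (Fin n → ℝ) :=
  ExteriorAlgebra.ιInv ∘ₗ (equivExterior (stdForm n)).toLinearMap

theorem vectorPart_ι (n : ℕ) (v : Fin n → ℝ) : vectorPart n (ι (stdForm n) v) = v := by
  have h : equivExterior (stdForm n) (ι (stdForm n) v) = ExteriorAlgebra.ι ℝ v := by
    simp only [equivExterior, changeFormEquiv_apply, changeForm_ι]
  simp only [vectorPart, LinearMap.comp_apply, LinearEquiv.coe_coe, h]
  exact ExteriorAlgebra.ι_leftInverse v

theorem conj_mem_range (n : ℕ) (s : Spin n) (v : Fin n → ℝ) :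
    (s : Cl n) * ι (stdForm n) v * star (s : Cl n) ∈ LinearMap.range (ι (stdForm n)) := by
  let x : (Cl n)ˣ := ⟨(s : Cl n), star (s : Cl n), spinGroup.mul_star_self_of_mem s.2,
    spinGroup.star_mul_self_of_mem s.2⟩
  have hx : (x : Cl n) ∈ spinGroup (stdForm n) := s.2
  have h := spinGroup.conjAct_smul_ι_mem_range_ι hx v
  rwa [ConjAct.units_smul_def, ConjAct.ofConjAct_toConjAct] at h

theorem ι_vectorPart_conj (n : ℕ) (s : Spin n) (v : Fin n → ℝ) :
    ι (stdForm n) (vectorPart n ((s : Cl n) * ι (stdForm n) v * star (s : Cl n))) =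
      (s : Cl n) * ι (stdForm n) v * star (s : Cl n) := by
  obtain ⟨w, hw⟩ := conj_mem_range n s v
  rw [← hw, vectorPart_ι]

/-- The vector representation `Spin(n) → SO(n) ⊂ End(ℝⁿ)`, `s ↦ (v ↦ s v s⁻¹)`
(recall `s⁻¹ = star s` in the spin group). -/
def vectorRep (n : ℕ) : Spin n →* Module.End ℝ (Fin n → ℝ) where
  toFun s :=
    { toFun := fun v => vectorPart n ((s : Cl n) * ι (stdForm n) v * star (s : Cl n))
      map_add' := fun v w => by simp only [map_add, mul_add, add_mul]
      map_smul' := fun c v => by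
        simp only [map_smul, Algebra.mul_smul_comm, Algebra.smul_mul_assoc, RingHom.id_apply] }
  map_one' := by
    refine LinearMap.ext fun v => ?_
    simp [vectorPart_ι]
  map_mul' s t := by
    refine LinearMap.ext fun v => ?_
    simp only [LinearMap.coe_mk, AddHom.coe_mk, Module.End.mul_apply, ι_vectorPart_conj]
    simp only [Submonoid.coe_mul, star_mul, mul_assoc]

theorem ι_vectorRep (n : ℕ) (s : Spin n) (v : Fin n → ℝ) :
    ι (stdForm n) (vectorRep n s v) = (s : Cl n) * ι (stdForm n) v * star (s : Cl n) :=
  ι_vectorPart_conj n s v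

/-- The inclusion `ℝⁿ → ℝⁿ⁺¹`, `v ↦ (0, v)`. -/
def consZero (n : ℕ) : stdForm n →qᵢ stdForm (n + 1) where
  toFun v := Fin.cons 0 v
  map_add' v w := by
    funext i
    refine Fin.cases ?_ (fun j => ?_) i <;> simp
  map_smul' c v := by
    funext i
    refine Fin.cases ?_ (fun j => ?_) i <;> simp
  map_app' v := by
    simp [QuadraticMap.weightedSumSquares_apply, Fin.sum_univ_succ]

/-- The induced map of Clifford algebras. -/
abbrev clMap (n : ℕ) : Cl n →ₐ[ℝ] Cl (n + 1) := CliffordAlgebra.map (consZero n)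

theorem clMap_star (n : ℕ) (x : Cl n) : clMap n (star x) = star (clMap n x) := by
  induction x using CliffordAlgebra.induction with
  | algebraMap r => simp [star_algebraMap]
  | ι v => simp [star_ι]
  | mul a b ha hb => simp only [star_mul, map_mul, ha, hb]
  | add a b ha hb => simp only [star_add, map_add, ha, hb]

theorem clMap_mem_lipschitz (n : ℕ) (x : (Cl n)ˣ) (hx : x ∈ lipschitzGroup (stdForm n)) :
    Units.map (clMap n : Cl n →* Cl (n + 1)) x ∈ lipschitzGroup (stdForm (n + 1)) := by
  unfold lipschitzGroup at hx ⊢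
  induction hx using Subgroup.closure_induction with
  | mem x hx =>
    obtain ⟨a, ha⟩ := hx
    refine Subgroup.subset_closure ⟨consZero n a, ?_⟩
    rw [Units.coe_map, ← ha]
    exact (CliffordAlgebra.map_apply_ι (consZero n) a).symm
  | one => rw [map_one]; exact one_mem _
  | mul a b _ _ ha hb => rw [map_mul]; exact mul_mem ha hb
  | inv a _ ha => rw [map_inv]; exact inv_mem ha

theorem clMap_mem_even (n : ℕ) (x : Cl n) (hx : x ∈ even (stdForm n)) :
    clMap n x ∈ even (stdForm (n + 1)) := by
  change clMap n x ∈ evenOdd (stdForm (n + 1)) 0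
  induction x, hx using CliffordAlgebra.even_induction with
  | algebraMap r =>
    rw [AlgHom.commutes]
    exact (even (stdForm (n + 1))).algebraMap_mem r
  | add x y hx hy ihx ihy =>
    rw [map_add]
    exact add_mem ihx ihy
  | ι_mul_ι_mul a b x hx ih =>
    rw [map_mul, map_mul, CliffordAlgebra.map_apply_ι, CliffordAlgebra.map_apply_ι]
    exact (even (stdForm (n + 1))).mul_mem (ι_mul_ι_mem_evenOdd_zero _ _ _) ih

theorem clMap_mem_spin (n : ℕ) (x : Cl n) (hx : x ∈ spinGroup (stdForm n)) :
    clMap n x ∈ spinGroup (stdForm (n + 1)) := by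
  rw [spinGroup.mem_iff, pinGroup.mem_iff] at hx ⊢
  obtain ⟨⟨⟨y, hy, rfl⟩, hu⟩, he⟩ := hx
  refine ⟨⟨⟨_, clMap_mem_lipschitz n y hy, rfl⟩, ?_⟩, clMap_mem_even n _ he⟩
  rw [Unitary.mem_iff] at hu ⊢
  rw [← clMap_star, ← map_mul, ← map_mul, hu.1, hu.2, map_one]
  exact ⟨rfl, rfl⟩

/-- The standard inclusion `Spin(n) → Spin(n+1)`, as the stabilizer of the first basis vector. -/
def spinIncl (n : ℕ) : Spin n →* Spin (n + 1) where
  toFun s := ⟨clMap n s, clMap_mem_spin n s s.2⟩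
  map_one' := Subtype.ext (map_one _)
  map_mul' _ _ := Subtype.ext (map_mul _ _ _)

/-! ## Groups with a fermion parity, and the groups `Spin(n) ×_{±1} G` -/

/-- A distinguished central element `parity = (-1)^F` of order two in a group. -/
class FermionParity (G : Type*) [Group G] where
  parity : G
  parity_ne_one : parity ≠ 1
  parity_mul_self : parity * parity = 1
  parity_comm : ∀ g : G, parity * g = g * parity

open FermionParity

/-- A continuous homomorphism that carries the parity element to the parity element. -/
structure ParityHom (G G' : Type*) [Group G] [TopologicalSpace G] [FermionParity G]
    [Group G'] [TopologicalSpace G'] [FermionParity G'] where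
  hom : G →* G'
  continuous_hom : Continuous hom
  map_parity : hom parity = parity

/-- Composition `k ∘ f`. -/
def ParityHom.comp {G G' G'' : Type*} [Group G] [TopologicalSpace G] [FermionParity G]
    [Group G'] [TopologicalSpace G'] [FermionParity G']
    [Group G''] [TopologicalSpace G''] [FermionParity G'']
    (k : ParityHom G' G'') (f : ParityHom G G') : ParityHom G G'' where
  hom := k.hom.comp f.hom
  continuous_hom := k.continuous_hom.comp f.continuous_hom
  map_parity := by simp [f.map_parity, k.map_parity]

/-- The subgroup `{(1, 1), (-1, (-1)^F)}` of `Spin(n) × G`. -/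
def diagonalParity (n : ℕ) (G : Type*) [Group G] [FermionParity G] :
    Subgroup (Spin n × G) where
  carrier := {p | p = 1 ∨ ((p.1 : Cl n) = -1 ∧ p.2 = parity)}
  one_mem' := Or.inl rfl
  mul_mem' := by
    rintro p q (rfl | ⟨hp, hp'⟩) (rfl | ⟨hq, hq'⟩)
    · left; simp
    · right; simpa using ⟨hq, hq'⟩
    · right; simpa using ⟨hp, hp'⟩
    · left
      refine Prod.ext (Subtype.ext ?_) ?_
      · simp [hp, hq]
      · simp [hp', hq', parity_mul_self]
  inv_mem' := by
    rintro p (rfl | ⟨hp, hp'⟩)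
    · left; simp
    · right
      refine ⟨?_, ?_⟩
      · rw [Prod.fst_inv, ← spinGroup.star_eq_inv, spinGroup.coe_star, hp]
        simp
      · rw [Prod.snd_inv, hp']
        exact inv_eq_of_mul_eq_one_left parity_mul_self

instance (n : ℕ) (G : Type*) [Group G] [FermionParity G] : (diagonalParity n G).Normal where
  conj_mem := by
    rintro p (rfl | ⟨hp, hp'⟩) q
    · left; simp
    · right
      refine ⟨?_, ?_⟩
      · simp only [Prod.fst_mul, Prod.fst_inv, Submonoid.coe_mul, hp]
        rw [← spinGroup.star_eq_inv, spinGroup.coe_star, mul_neg, mul_one, neg_mul,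
          spinGroup.mul_star_self_of_mem q.1.2]
      · simp only [Prod.snd_mul, Prod.snd_inv, hp']
        rw [← parity_comm, mul_inv_cancel_right]

/-- The group `Spin(n) ×_{±1} G`, with the quotient topology. -/
abbrev SpinG (n : ℕ) (G : Type*) [Group G] [FermionParity G] : Type _ :=
  (Spin n × G) ⧸ diagonalParity n G

section SpinG

variable (n : ℕ) (G : Type*) [Group G] [FermionParity G]

/-- The homomorphism `Spin(n) ×_{±1} G → SO(n) ⊂ End(ℝⁿ)`, `[s, g] ↦ (v ↦ s v s⁻¹)`. -/
def SpinG.rep : SpinG n G →* Module.End ℝ (Fin n → ℝ) :=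
  QuotientGroup.lift (diagonalParity n G) ((vectorRep n).comp (MonoidHom.fst (Spin n) G)) (by
    rintro p (rfl | ⟨hp, _⟩)
    · exact map_one _
    · refine LinearMap.ext fun v => ?_
      change vectorPart n ((p.1 : Cl n) * ι (stdForm n) v * star (p.1 : Cl n)) = v
      rw [hp]
      simp [vectorPart_ι])

/-- The inclusion `Spin(n) ×_{±1} G → Spin(n+1) ×_{±1} G`. -/
def SpinG.incl : SpinG n G →* SpinG (n + 1) G :=
  QuotientGroup.map _ _ ((spinIncl n).prodMap (MonoidHom.id G)) (by
    rintro p (rfl | ⟨hp, hp'⟩)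
    · exact Or.inl (map_one _)
    · refine Or.inr ⟨?_, hp'⟩
      change clMap n (p.1 : Cl n) = -1
      rw [hp, map_neg, map_one])

end SpinG

/-- The homomorphism `[s, g] ↦ [s, f g]` induced by `f : G → G'`. -/
def SpinG.map (n : ℕ) {G G' : Type*} [Group G] [TopologicalSpace G] [FermionParity G]
    [Group G'] [TopologicalSpace G'] [FermionParity G'] (f : ParityHom G G') :
    SpinG n G →* SpinG n G' :=
  QuotientGroup.map _ _ ((MonoidHom.id (Spin n)).prodMap f.hom) (by
    rintro p (rfl | ⟨hp, hp'⟩)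
    · exact Or.inl (map_one _)
    · refine Or.inr ⟨hp, ?_⟩
      change f.hom p.2 = parity
      rw [hp', f.map_parity])

theorem SpinG.continuous_map (n : ℕ) {G G' : Type*} [Group G] [TopologicalSpace G]
    [FermionParity G] [Group G'] [TopologicalSpace G'] [FermionParity G']
    (f : ParityHom G G') : Continuous (SpinG.map n f) := by
  refine continuous_quot_lift _ ?_
  exact continuous_quot_mk.comp (continuous_id.prodMap f.continuous_hom)

theorem SpinG.rep_map (n : ℕ) {G G' : Type*} [Group G] [TopologicalSpace G]
    [FermionParity G] [Group G'] [TopologicalSpace G'] [FermionParity G']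
    (f : ParityHom G G') (h : SpinG n G) : SpinG.rep n G' (SpinG.map n f h) = SpinG.rep n G h := by
  induction h using QuotientGroup.induction_on
  rfl

/-! ## Spin-`G` structures on manifolds -/

/-- A Spin-`G` structure on a manifold `X` of dimension `d` (possibly with boundary): a principal
`Spin(d) ×_{±1} G`-bundle together with an equivariant map to the bundle of frames of `TX`,
presented by transition functions. Over the members of an open cover one has continuous local
frames of `TX`, written as isomorphisms `ℝᵈ ≃ T_x X`, and a continuous cocycle of transition
functions in `Spin(d) ×_{±1} G` whose image in `SO(d)` is the cocycle of changes of frame. In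
particular the frames determine an orientation and a metric on `X`. The values of `frame a` and
`trans a b` away from `patch a` and `patch a ∩ patch b` are irrelevant. -/
structure SpinStructure (d : ℕ) (G : Type*) [Group G] [TopologicalSpace G] [FermionParity G]
    {E H : Type*} [NormedAddCommGroup E] [NormedSpace ℝ E] [TopologicalSpace H]
    (J : ModelWithCorners ℝ E H) (X : Type u) [TopologicalSpace X] [ChartedSpace H X]
    [IsManifold J ∞ X] where
  Index : Type u
  patch : Index → Set X
  isOpen_patch : ∀ a, IsOpen (patch a)
  cover : ∀ x, ∃ a, x ∈ patch a
  frame : Index → ∀ x : X, (Fin d → ℝ) ≃ₗ[ℝ] TangentSpace J x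
  continuousOn_frame : ∀ a v,
    ContinuousOn (fun x => (⟨x, frame a x v⟩ : TangentBundle J X)) (patch a)
  trans : Index → Index → X → SpinG d G
  continuousOn_trans : ∀ a b, ContinuousOn (trans a b) (patch a ∩ patch b)
  trans_cocycle : ∀ a b c, ∀ x ∈ patch a ∩ patch b ∩ patch c,
    trans a b x * trans b c x = trans a c x
  frame_trans : ∀ a b, ∀ x ∈ patch a ∩ patch b, ∀ v,
    frame b x v = frame a x (SpinG.rep d G (trans a b x) v)

/-- The Spin-`G'` structure induced by a homomorphism `G → G'`. -/
def SpinStructure.induced {d : ℕ} {G G' : Type*} [Group G] [TopologicalSpace G]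
    [FermionParity G] [Group G'] [TopologicalSpace G'] [FermionParity G']
    {E H : Type*} [NormedAddCommGroup E] [NormedSpace ℝ E] [TopologicalSpace H]
    {J : ModelWithCorners ℝ E H} {X : Type u} [TopologicalSpace X] [ChartedSpace H X]
    [IsManifold J ∞ X] (S : SpinStructure d G J X) (f : ParityHom G G') :
    SpinStructure d G' J X where
  Index := S.Index
  patch := S.patch
  isOpen_patch := S.isOpen_patch
  cover := S.cover
  frame := S.frame
  continuousOn_frame := S.continuousOn_frame
  trans a b x := SpinG.map d f (S.trans a b x)
  continuousOn_trans a b := (SpinG.continuous_map d f).comp_continuousOn (S.continuousOn_trans a b)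
  trans_cocycle a b c x hx := by rw [← map_mul, S.trans_cocycle a b c x hx]
  frame_trans a b x hx v := by rw [SpinG.rep_map, S.frame_trans a b x hx v]

/-! ## Bordism of Spin-`G` manifolds -/

/-- Model of `(n+1)`-manifolds with boundary: the half-space `ℝⁿ × [0, ∞)`. -/
abbrev HalfSpace (n : ℕ) : Type :=
  ModelProd (EuclideanSpace ℝ (Fin n)) (EuclideanHalfSpace 1)

/-- The half-space `ℝⁿ × [0, ∞)` as a model with corners, inside `ℝⁿ × ℝ`. -/
abbrev halfModel (n : ℕ) : ModelWithCorners ℝ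
    (EuclideanSpace ℝ (Fin n) × EuclideanSpace ℝ (Fin 1)) (HalfSpace n) :=
  (𝓡 n).prod (𝓡∂ 1)

/-- The last coordinate of a tangent vector at `w` in the preferred chart at `w`, with values in
`ℝⁿ × [0, ∞)`. At a boundary point, the vector points strictly inwards if and only if it is
positive, and strictly outwards if and only if it is negative. -/
def normalCoord {n : ℕ} {W : Type*} [TopologicalSpace W] [ChartedSpace (HalfSpace n) W] {w : W}
    (v : TangentSpace (halfModel n) w) : ℝ :=
  (show EuclideanSpace ℝ (Fin n) × EuclideanSpace ℝ (Fin 1) from v).2 0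

/-- An identification, over a boundary inclusion `φ : M → W`, of the restriction to `M` of a
Spin-`G` structure `T` on `W` with the stabilization of a Spin-`G` structure `S` on `M`. It is an
isomorphism `compare` of principal `Spin(n+1) ×_{±1} G`-bundles (given in terms of the local
trivializations) which over the frame bundles covers an isomorphism `ℝ ⊕ TM ≅ φ^* TW` that is `dφ`
on `TM`, and takes the first basis vector to a field of vectors pointing strictly inwards
(`inward = 1`) or strictly outwards (`inward = -1`). -/
structure BoundaryIdentification {n : ℕ} {G : Type*} [Group G] [TopologicalSpace G]
    [FermionParity G] {M W : Type u}
    [TopologicalSpace M] [ChartedSpace (EuclideanSpace ℝ (Fin n)) M] [IsManifold (𝓡 n) ∞ M]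
    [TopologicalSpace W] [ChartedSpace (HalfSpace n) W] [IsManifold (halfModel n) ∞ W]
    (S : SpinStructure n G (𝓡 n) M) (T : SpinStructure (n + 1) G (halfModel n) W)
    (φ : M → W) (inward : ℝ) where
  compare : T.Index → S.Index → M → SpinG (n + 1) G
  continuousOn_compare : ∀ a α, ContinuousOn (compare a α) (φ ⁻¹' T.patch a ∩ S.patch α)
  trans_compare : ∀ a b α, ∀ x ∈ S.patch α, φ x ∈ T.patch a → φ x ∈ T.patch b →
    T.trans b a (φ x) * compare a α x = compare b α x
  compare_trans : ∀ a α β, ∀ x ∈ S.patch α ∩ S.patch β, φ x ∈ T.patch a →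
    compare a α x * SpinG.incl n G (S.trans α β x) = compare a β x
  frame_tangent : ∀ a α, ∀ x ∈ S.patch α, φ x ∈ T.patch a → ∀ v : Fin n → ℝ,
    T.frame a (φ x) (SpinG.rep (n + 1) G (compare a α x) (Fin.cons 0 v)) =
      mfderiv (𝓡 n) (halfModel n) φ x (S.frame α x v)
  frame_normal : ∀ a α, ∀ x ∈ S.patch α, φ x ∈ T.patch a →
    0 < inward * normalCoord
      (T.frame a (φ x) (SpinG.rep (n + 1) G (compare a α x) (Pi.single 0 1)))

/-- A bordism of Spin-`G` manifolds from `(M₀, S₀)` to `(M₁, S₁)`: a compact Spin-`G` manifold `W`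
with boundary, whose boundary is identified by smooth embeddings with `M₀ ⊔ M₁`, compatibly with
the Spin-`G` structures. As usual in oriented bordism, the extra tangent direction is the inward
normal along the incoming end `M₀` and the outward normal along the outgoing end `M₁`. -/
structure Bordism {n : ℕ} {G : Type*} [Group G] [TopologicalSpace G] [FermionParity G]
    {M₀ M₁ : Type u}
    [TopologicalSpace M₀] [ChartedSpace (EuclideanSpace ℝ (Fin n)) M₀] [IsManifold (𝓡 n) ∞ M₀]
    [TopologicalSpace M₁] [ChartedSpace (EuclideanSpace ℝ (Fin n)) M₁] [IsManifold (𝓡 n) ∞ M₁]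
    (S₀ : SpinStructure n G (𝓡 n) M₀) (S₁ : SpinStructure n G (𝓡 n) M₁) where
  W : Type u
  [topologicalSpace : TopologicalSpace W]
  [chartedSpace : ChartedSpace (HalfSpace n) W]
  [isManifold : IsManifold (halfModel n) ∞ W]
  [compactSpace : CompactSpace W]
  [t2Space : T2Space W]
  T : SpinStructure (n + 1) G (halfModel n) W
  φ₀ : M₀ → W
  φ₁ : M₁ → W
  contMDiff₀ : ContMDiff (𝓡 n) (halfModel n) ∞ φ₀
  contMDiff₁ : ContMDiff (𝓡 n) (halfModel n) ∞ φ₁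
  isEmbedding₀ : Topology.IsEmbedding φ₀
  isEmbedding₁ : Topology.IsEmbedding φ₁
  immersion₀ : ∀ x, Function.Injective (mfderiv (𝓡 n) (halfModel n) φ₀ x)
  immersion₁ : ∀ x, Function.Injective (mfderiv (𝓡 n) (halfModel n) φ₁ x)
  disjoint_range : Disjoint (Set.range φ₀) (Set.range φ₁)
  range_union : Set.range φ₀ ∪ Set.range φ₁ = (halfModel n).boundary W
  incoming : BoundaryIdentification S₀ T φ₀ 1
  outgoing : BoundaryIdentification S₁ T φ₁ (-1)

/-- Two closed Spin-`G` manifolds are bordant. -/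
def Bordant {n : ℕ} {G : Type*} [Group G] [TopologicalSpace G] [FermionParity G]
    {M₀ M₁ : Type u}
    [TopologicalSpace M₀] [ChartedSpace (EuclideanSpace ℝ (Fin n)) M₀] [IsManifold (𝓡 n) ∞ M₀]
    [TopologicalSpace M₁] [ChartedSpace (EuclideanSpace ℝ (Fin n)) M₁] [IsManifold (𝓡 n) ∞ M₁]
    (S₀ : SpinStructure n G (𝓡 n) M₀) (S₁ : SpinStructure n G (𝓡 n) M₁) : Prop :=
  Nonempty (Bordism S₀ S₁)

/-! ## The Pin⁺ covers `GL⁺(2, ℝ)` and `GL⁺(2, ℤ)` -/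

/-- The action of a real `2 × 2` matrix on the plane `ℝ² = ℂ`. -/
def planeAct (A : GL (Fin 2) ℝ) (z : ℂ) : ℂ :=
  ⟨A 0 0 * z.re + A 0 1 * z.im, A 1 0 * z.re + A 1 1 * z.im⟩

theorem planeAct_one (z : ℂ) : planeAct 1 z = z := by
  apply Complex.ext <;> simp [planeAct]

theorem planeAct_mul (A B : GL (Fin 2) ℝ) (z : ℂ) :
    planeAct (A * B) z = planeAct A (planeAct B z) := by
  apply Complex.ext <;>
    simp only [planeAct, Units.val_mul, Matrix.mul_apply, Fin.sum_univ_two] <;> ring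

/-- The Pin⁺ cover `GL⁺(2, ℝ)` of `GL(2, ℝ)`, realized as the group of lifts of linear maps along
the double cover `ℂˣ → ℂˣ`, `z ↦ z²`: its elements are the pairs `(A, σ)` of an invertible real
matrix `A` and a homeomorphism `σ` of `ℂˣ` with `σ(z)² = A(z²)`. Each `A` has precisely two lifts
`± σ`; the lifts `z ↦ e^{iθ/2} z` of rotations show that the cover is the non-trivial one over the
identity component, and the reflection `z ↦ conj z` lifts to `± conj`, which squares to `1`. -/
def GLPlusRSubgroup : Subgroup (GL (Fin 2) ℝ × (ℂˣ ≃ₜ ℂˣ)) where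
  carrier := {p | ∀ z : ℂˣ, ((p.2 z : ℂˣ) : ℂ) ^ 2 = planeAct p.1 ((z : ℂ) ^ 2)}
  one_mem' z := by simp [planeAct_one]
  mul_mem' {p q} hp hq z := by
    rw [Prod.fst_mul, planeAct_mul, ← hq z, ← hp (q.2 z)]
    rfl
  inv_mem' {p} hp z := by
    have h := hp (p.2.symm z)
    rw [Homeomorph.apply_symm_apply] at h
    rw [h, Prod.fst_inv, ← planeAct_mul, inv_mul_cancel, planeAct_one]
    rfl

/-- The group `GL⁺(2, ℝ)`. -/
abbrev GLPlusR : Type := GLPlusRSubgroup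

/-- A lift `(A, σ)` is determined by `A` and the square root `σ(1)` of `A(1)`; the topology of
`GL⁺(2, ℝ)` is that of the double cover `{(A, w) | w² = A(1)} ⊂ GL(2, ℝ) × ℂˣ` of `GL(2, ℝ)`. -/
instance : TopologicalSpace GLPlusR :=
  TopologicalSpace.induced (fun p : GLPlusR => (p.1.1, p.1.2 1)) inferInstance

/-- The covering homomorphism `GL⁺(2, ℝ) → GL(2, ℝ)`. -/
def GLPlusR.proj : GLPlusR →* GL (Fin 2) ℝ :=
  (MonoidHom.fst (GL (Fin 2) ℝ) (ℂˣ ≃ₜ ℂˣ)).comp GLPlusRSubgroup.subtype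

/-- The non-trivial lift of the identity matrix, `z ↦ -z`. -/
def GLPlusR.negOne : GLPlusR :=
  ⟨(1, Homeomorph.mulLeft (-1 : ℂˣ)), fun z => by simp [planeAct_one]⟩

theorem mulLeft_mul_self_neg_one :
    (Homeomorph.mulLeft (-1 : ℂˣ)) * Homeomorph.mulLeft (-1 : ℂˣ) = 1 := by
  ext z
  change (((-1 : ℂˣ) * ((-1 : ℂˣ) * z) : ℂˣ) : ℂ) = z
  simp

/-- A homeomorphism lifting a linear map along `z ↦ z²` commutes with the deck transformation. -/
theorem lift_neg (p : GLPlusR) (z : ℂˣ) : p.1.2 (-z) = -p.1.2 z := by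
  have h1 := p.2 z
  have h2 := p.2 (-z)
  have h3 : ((p.1.2 (-z) : ℂˣ) : ℂ) ^ 2 = ((p.1.2 z : ℂˣ) : ℂ) ^ 2 := by
    rw [h1, h2]; simp
  rcases sq_eq_sq_iff_eq_or_eq_neg.mp h3 with h | h
  · have h4 : p.1.2 (-z) = p.1.2 z := Units.ext h
    have h5 : -z = z := p.1.2.injective h4
    have h6 : -(z : ℂ) = z := by
      have := congrArg (Units.val) h5
      simpa using this
    exact absurd (self_eq_neg.mp h6.symm) z.ne_zero
  · exact Units.ext (by simpa using h)

instance : FermionParity GLPlusR where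
  parity := GLPlusR.negOne
  parity_ne_one h := by
    have h1 : GLPlusR.negOne.1.2 1 = (1 : GLPlusR).1.2 1 := by rw [h]
    have h2 : ((-1 : ℂˣ) * 1 : ℂˣ) = 1 := h1
    have h3 := congrArg Units.val h2
    norm_num at h3
  parity_mul_self := Subtype.ext (Prod.ext (one_mul 1) mulLeft_mul_self_neg_one)
  parity_comm p := by
    refine Subtype.ext (Prod.ext ?_ ?_)
    · change 1 * p.1.1 = p.1.1 * 1
      rw [one_mul, mul_one]
    · ext1 z
      change (-1 : ℂˣ) * p.1.2 z = p.1.2 ((-1 : ℂˣ) * z)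
      rw [neg_one_mul, neg_one_mul, lift_neg]

/-- The Pin⁺ cover `GL⁺(2, ℤ)` of `GL(2, ℤ)`: the preimage of `GL(2, ℤ)` in `GL⁺(2, ℝ)`. -/
def GLPlusZSubgroup : Subgroup GLPlusR :=
  (Matrix.GeneralLinearGroup.map (n := Fin 2) (Int.castRingHom ℝ)).range.comap GLPlusR.proj

/-- The group `GL⁺(2, ℤ)`, with the subspace topology (which is discrete). -/
abbrev GLPlusZ : Type := GLPlusZSubgroup

instance : FermionParity GLPlusZ where
  parity := ⟨parity, ⟨1, map_one _⟩⟩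
  parity_ne_one h := parity_ne_one (G := GLPlusR) (congrArg Subtype.val h)
  parity_mul_self := Subtype.ext parity_mul_self
  parity_comm p := Subtype.ext (parity_comm p.1)

/-- The inclusion `j : GL⁺(2, ℤ) → GL⁺(2, ℝ)`. -/
def inclusionZR : ParityHom GLPlusZ GLPlusR where
  hom := GLPlusZSubgroup.subtype
  continuous_hom := continuous_subtype_val
  map_parity := rfl

/-! ## The dihedral groups and their embeddings

`DihedralGroup m` is the group of symmetries of a regular `m`-gon, of order `2m`; so the dihedral
groups of order `8` and `16` are `DihedralGroup 4` and `DihedralGroup 8`. In Mathlib's notation,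
`r k` is the `k`-th power of the standard rotation, and `sr k = sr 0 * r k` with `sr 0` the standard
reflection. -/

/-- Dihedral groups are discrete. -/
instance (m : ℕ) : TopologicalSpace (DihedralGroup m) := ⊥

instance (m : ℕ) : DiscreteTopology (DihedralGroup m) := ⟨rfl⟩

/-- Fermion parity in the dihedral group of order 8: the square of the rotation `r`. -/
instance : FermionParity (DihedralGroup 4) where
  parity := .r 2
  parity_ne_one := by decide
  parity_mul_self := by decide
  parity_comm := by decide

/-- Fermion parity in the dihedral group of order 16: the fourth power of the rotation `r`. -/
instance : FermionParity (DihedralGroup 8) where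
  parity := .r 4
  parity_ne_one := by decide
  parity_mul_self := by decide
  parity_comm := by decide

/-- The homomorphism from a dihedral group given by elements `a`, `b` satisfying the relations
`aᵐ = b² = 1`, `b a b = a⁻¹`; it sends the rotation `r` to `a` and the reflection `s` to `b`. -/
def dihedralLift (m : ℕ) {G : Type*} [Group G] (a b : G) (ha : a ^ m = 1) (hb : b * b = 1)
    (hab : b * a * b = a⁻¹) : DihedralGroup m →* G :=
  have key : ∀ k l : ℤ, ((k : ZMod m) = l) → a ^ k = a ^ l := fun k l h => by
    obtain ⟨c, hc⟩ := (ZMod.intCast_eq_intCast_iff_dvd_sub _ _ _).mp h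
    rw [show l = k + m * c by omega, zpow_add, zpow_mul, zpow_natCast, ha, one_zpow, mul_one]
  have hbinv : b⁻¹ = b := inv_eq_of_mul_eq_one_left hb
  have conj : ∀ k : ℤ, a ^ k * b = b * a ^ (-k) := fun k => by
    have h1 : (b * a * b⁻¹) ^ k = b * a ^ k * b⁻¹ := conj_zpow
    rw [hbinv, hab, inv_zpow, ← zpow_neg] at h1
    rw [h1, ← mul_assoc, ← mul_assoc, hb, one_mul]
  { toFun := fun g => match g with
      | .r k => a ^ (k.cast : ℤ)
      | .sr k => b * a ^ (k.cast : ℤ)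
    map_one' := by
      change a ^ (((0 : ZMod m).cast : ℤ)) = 1
      simp
    map_mul' := by
      rintro (k | k) (l | l)
      · change a ^ (((k + l : ZMod m)).cast : ℤ) = a ^ (k.cast : ℤ) * a ^ (l.cast : ℤ)
        rw [← zpow_add]
        exact key _ _ (by simp)
      · change b * a ^ (((l - k : ZMod m)).cast : ℤ) = a ^ (k.cast : ℤ) * (b * a ^ (l.cast : ℤ))
        rw [← mul_assoc, conj, mul_assoc, ← zpow_add]
        exact congrArg (b * ·) (key _ _ (by simp; ring))
      · change b * a ^ (((k + l : ZMod m)).cast : ℤ) = b * a ^ (k.cast : ℤ) * a ^ (l.cast : ℤ)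
        rw [mul_assoc, ← zpow_add]
        exact congrArg (b * ·) (key _ _ (by simp))
      · change a ^ (((l - k : ZMod m)).cast : ℤ) = b * a ^ (k.cast : ℤ) * (b * a ^ (l.cast : ℤ))
        rw [mul_assoc, ← mul_assoc (a ^ (k.cast : ℤ)), conj, mul_assoc, ← mul_assoc b b, hb,
          one_mul, ← zpow_add]
        exact key _ _ (by simp; ring) }

/-- The embedding `i : D₈ → D₁₆` (groups of order 8 and 16) with `r ↦ r²`, `s ↦ s`. -/
def embI : ParityHom (DihedralGroup 4) (DihedralGroup 8) where
  hom := dihedralLift 4 (.r 2) (.sr 0) (by decide) (by decide) (by decide)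
  continuous_hom := continuous_of_discreteTopology
  map_parity := by decide

/-- The embedding `ĩ : D₈ → D₁₆` with `r ↦ r²`, `s ↦ r s`: the image of `s` is the reflection in a
line that makes an angle of `π/8` with the line of the reflection `s`. -/
def embITilde : ParityHom (DihedralGroup 4) (DihedralGroup 8) where
  hom := dihedralLift 4 (.r 2) (.r 1 * .sr 0) (by decide) (by decide) (by decide)
  continuous_hom := continuous_of_discreteTopology
  map_parity := by decide

/-- The matrix `S`, rotation of the plane by `π/2`. -/
def matS : GL (Fin 2) ℤ where
  val := !![0, -1; 1, 0]
  inv := !![0, 1; -1, 0]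
  val_inv := by decide
  inv_val := by decide

/-- The matrix `R`, a reflection. -/
def matR : GL (Fin 2) ℤ where
  val := !![0, 1; 1, 0]
  inv := !![0, 1; 1, 0]
  val_inv := by decide
  inv_val := by decide

/-- The eighth root of unity `e^{iπ/4} = (1 + i)/√2`. -/
def zeta : ℂˣ where
  val := ⟨(√2)⁻¹, (√2)⁻¹⟩
  inv := ⟨(√2)⁻¹, -(√2)⁻¹⟩
  val_inv := by
    have h : (√2)⁻¹ * (√2)⁻¹ = (2 : ℝ)⁻¹ := by
      rw [← mul_inv, Real.mul_self_sqrt (by norm_num)]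
    refine Complex.ext ?_ ?_ <;> (simp; try linarith)
  inv_val := by
    have h : (√2)⁻¹ * (√2)⁻¹ = (2 : ℝ)⁻¹ := by
      rw [← mul_inv, Real.mul_self_sqrt (by norm_num)]
    refine Complex.ext ?_ ?_ <;> (simp; try linarith)

theorem zeta_sq : (zeta : ℂ) ^ 2 = Complex.I := by
  have h : (√2)⁻¹ * (√2)⁻¹ = (2 : ℝ)⁻¹ := by
    rw [← mul_inv, Real.mul_self_sqrt (by norm_num)]
  rw [sq]
  refine Complex.ext ?_ ?_ <;> (simp [zeta]; try linarith)

theorem zeta_pow_four : zeta ^ 4 = -1 := by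
  ext
  rw [Units.val_pow_eq_pow_val, show (4 : ℕ) = 2 * 2 from rfl, pow_mul, zeta_sq]
  simp

theorem conj_zeta : (starRingEnd ℂ) (zeta : ℂ) = ((zeta⁻¹ : ℂˣ) : ℂ) := by
  apply Complex.ext
  · change (√2)⁻¹ = (√2)⁻¹
    rfl
  · change -(√2)⁻¹ = -(√2)⁻¹
    rfl

/-- Complex conjugation on `ℂˣ`. -/
def conjUnits : ℂˣ ≃* ℂˣ := Units.mapEquiv (starRingAut : ℂ ≃+* ℂ).toMulEquiv

theorem coe_conjUnits (z : ℂˣ) : ((conjUnits z : ℂˣ) : ℂ) = (starRingEnd ℂ) (z : ℂ) := rfl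

theorem conjUnits_conjUnits (z : ℂˣ) : conjUnits (conjUnits z) = z := by
  ext
  simp [coe_conjUnits]

theorem conjUnits_zeta : conjUnits zeta = zeta⁻¹ := Units.ext conj_zeta

theorem continuous_conjUnits : Continuous conjUnits :=
  Continuous.units_map ((starRingEnd ℂ : ℂ →+* ℂ) : ℂ →* ℂ) Complex.continuous_conj

/-- Complex conjugation as a homeomorphism of `ℂˣ`. -/
def conjHomeo : ℂˣ ≃ₜ ℂˣ where
  toEquiv := ⟨conjUnits, conjUnits, conjUnits_conjUnits, conjUnits_conjUnits⟩
  continuous_toFun := continuous_conjUnits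
  continuous_invFun := continuous_conjUnits

/-- The generator `Ŝ` of `GL⁺(2, ℤ)`: the lift `z ↦ e^{iπ/4} z` of `S`. -/
def hatS : GLPlusZ :=
  ⟨⟨(Matrix.GeneralLinearGroup.map (Int.castRingHom ℝ) matS, Homeomorph.mulLeft zeta), fun z => by
    change ((zeta : ℂ) * (z : ℂ)) ^ 2 = _
    rw [mul_pow, zeta_sq]
    apply Complex.ext <;> simp [planeAct, matS]⟩, ⟨matS, rfl⟩⟩

/-- The generator `R̂` of `GL⁺(2, ℤ)`: the lift `z ↦ e^{iπ/4} conj z` of `R`. -/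
def hatR : GLPlusZ :=
  ⟨⟨(Matrix.GeneralLinearGroup.map (Int.castRingHom ℝ) matR,
      Homeomorph.mulLeft zeta * conjHomeo), fun z => by
    change ((zeta : ℂ) * (starRingEnd ℂ) (z : ℂ)) ^ 2 = _
    rw [mul_pow, zeta_sq, ← map_pow]
    generalize (z : ℂ) ^ 2 = w
    apply Complex.ext <;> simp [planeAct, matR]⟩, ⟨matR, rfl⟩⟩

theorem GLPlusZ.ext' {p q : GLPlusZ} (h1 : p.1.1.1 = q.1.1.1)
    (h2 : ∀ z : ℂˣ, p.1.1.2 z = q.1.1.2 z) : p = q :=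
  Subtype.ext (Subtype.ext (Prod.ext h1 (Homeomorph.ext h2)))

theorem hatS_pow_four : hatS ^ 4 = parity := by
  refine GLPlusZ.ext' ?_ fun z => ?_
  · change (Matrix.GeneralLinearGroup.map (Int.castRingHom ℝ) matS) ^ 4 = 1
    rw [← map_pow, show matS ^ 4 = 1 by decide, map_one]
  · change zeta * (zeta * (zeta * (zeta * z))) = -1 * z
    rw [← zeta_pow_four]
    simp only [pow_succ, pow_zero, one_mul, mul_assoc]

theorem hatS_pow_eight : hatS ^ 8 = 1 := by
  rw [show (8 : ℕ) = 4 * 2 from rfl, pow_mul, hatS_pow_four, pow_two, parity_mul_self]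

theorem hatR_mul_self : hatR * hatR = 1 := by
  refine GLPlusZ.ext' ?_ fun z => ?_
  · change Matrix.GeneralLinearGroup.map (Int.castRingHom ℝ) matR *
      Matrix.GeneralLinearGroup.map (Int.castRingHom ℝ) matR = 1
    rw [← map_mul, show matR * matR = 1 by decide, map_one]
  · change zeta * conjUnits (zeta * conjUnits z) = z
    rw [map_mul, conjUnits_conjUnits, conjUnits_zeta, mul_inv_cancel_left]

theorem hatR_hatS_hatR : hatR * hatS * hatR = hatS⁻¹ := by
  rw [eq_inv_iff_mul_eq_one]
  refine GLPlusZ.ext' ?_ fun z => ?_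
  · change Matrix.GeneralLinearGroup.map (Int.castRingHom ℝ) matR *
      Matrix.GeneralLinearGroup.map (Int.castRingHom ℝ) matS *
      Matrix.GeneralLinearGroup.map (Int.castRingHom ℝ) matR *
      Matrix.GeneralLinearGroup.map (Int.castRingHom ℝ) matS = 1
    rw [← map_mul, ← map_mul, ← map_mul, show matR * matS * matR * matS = 1 by decide, map_one]
  · change zeta * conjUnits (zeta * (zeta * conjUnits (zeta * z))) = z
    simp only [map_mul, conjUnits_conjUnits, conjUnits_zeta, map_inv, inv_inv]
    rw [inv_mul_cancel_left, mul_inv_cancel_left]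

/-- The embedding `D₁₆ → GL⁺(2, ℤ)` with `r ↦ Ŝ`, `s ↦ R̂`. -/
def dihedralToGL : ParityHom (DihedralGroup 8) GLPlusZ where
  hom := dihedralLift 8 hatS hatR hatS_pow_eight hatR_mul_self hatR_hatS_hatR
  continuous_hom := continuous_of_discreteTopology
  map_parity := by
    rw [← hatS_pow_four]
    change hatS ^ (((4 : ZMod 8).cast : ℤ)) = hatS ^ 4
    rw [show ((4 : ZMod 8).cast : ℤ) = ((4 : ℕ) : ℤ) by decide, zpow_natCast]

end

end SpinTwist

/-!
The two homomorphisms `D₈ → GL⁺(2, ℤ)` become conjugate in `GL⁺(2, ℝ)`. Both send `r` to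
multiplication by `ζ² = i`, and they send `s` to `z ↦ ζ z̄` and to `z ↦ ζ² z̄`, where
`ζ = e^{iπ/4}`. Multiplication by `η = e^{iπ/8}`, which lifts the rotation of the plane by `π/4`,
commutes with the former and conjugates one reflection into the other, because `η² = ζ`.

Structures induced by conjugate homomorphisms are isomorphic, hence bordant: the bordism is the
cylinder `M × [0, 1]` with the structure pulled back from `M` and stabilized (`cylinder`), where the
extra tangent direction is the unit vector field `∂ₜ` of the interval. This field points inwards at
`0` and outwards at `1`, as the orientation convention asks. The incoming end is identified
tautologically, and the outgoing end through multiplication by `[1, c]` with `c` the conjugating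
element; both are instances of `cylinderEnd`. Over the frame bundles this does nothing, since
`[1, c]` acts trivially on `ℝⁿ⁺¹`.
-/

open scoped Manifold ContDiff
open CliffordAlgebra

namespace SpinTwist

noncomputable section

open FermionParity Set

/-! ### The stabilization `Spin(n) ×_{±1} G → Spin(n+1) ×_{±1} G` -/

theorem continuous_spinIncl (n : ℕ) : Continuous (spinIncl n) := by
  have : ContinuousAdd (Cl (n + 1)) := IsModuleTopology.toContinuousAdd ℝ _
  have h : Continuous (clMap n) := IsModuleTopology.continuous_of_linearMap (clMap n).toLinearMap
  exact (h.comp continuous_subtype_val).subtype_mk _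

theorem consZero_isOrtho (n : ℕ) (v : Fin n → ℝ) :
    QuadraticMap.IsOrtho (stdForm (n + 1)) (Pi.single 0 1) (consZero n v) := by
  rw [QuadraticMap.isOrtho_def]
  change stdForm (n + 1) (Pi.single 0 1 + Fin.cons 0 v) =
    stdForm (n + 1) (Pi.single 0 1) + stdForm (n + 1) (Fin.cons 0 v)
  simp [QuadraticMap.weightedSumSquares_apply, Fin.sum_univ_succ]

/-- The first basis vector anticommutes with the other ones, hence commutes with even elements. -/
theorem ι_single_mul_clMap (n : ℕ) (x : Cl n) (hx : x ∈ even (stdForm n)) :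
    ι (stdForm (n + 1)) (Pi.single 0 1) * clMap n x =
      clMap n x * ι (stdForm (n + 1)) (Pi.single 0 1) := by
  have anti := fun v => ι_mul_ι_comm_of_isOrtho (consZero_isOrtho n v)
  induction x, hx using CliffordAlgebra.even_induction with
  | algebraMap r => rw [AlgHom.commutes, Algebra.commutes]
  | add x y hx hy ihx ihy => rw [map_add, mul_add, add_mul, ihx, ihy]
  | ι_mul_ι_mul a b x hx ih =>
    simp only [map_mul, CliffordAlgebra.map_apply_ι]
    rw [← mul_assoc, ← mul_assoc, anti a, neg_mul, mul_assoc (ι _ (consZero n a)), anti b,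
      mul_neg, neg_neg, mul_assoc, mul_assoc, ih]
    simp only [mul_assoc]

theorem vectorRep_spinIncl_cons (n : ℕ) (s : Spin n) (v : Fin n → ℝ) :
    vectorRep (n + 1) (spinIncl n s) (Fin.cons 0 v) = Fin.cons 0 (vectorRep n s v) := by
  apply (Function.LeftInverse.injective (vectorPart_ι (n + 1)))
  rw [ι_vectorRep]
  change clMap n s * ι _ (consZero n v) * star (clMap n s) = ι _ (consZero n (vectorRep n s v))
  rw [← clMap_star, ← CliffordAlgebra.map_apply_ι, ← CliffordAlgebra.map_apply_ι, ι_vectorRep,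
    map_mul, map_mul]

theorem vectorRep_spinIncl_single (n : ℕ) (s : Spin n) :
    vectorRep (n + 1) (spinIncl n s) (Pi.single 0 1) = Pi.single 0 1 := by
  apply (Function.LeftInverse.injective (vectorPart_ι (n + 1)))
  rw [ι_vectorRep]
  change clMap n s * ι _ (Pi.single 0 1) * star (clMap n s) = _
  rw [← ι_single_mul_clMap n s (spinGroup.mem_even s.2), mul_assoc, ← clMap_star, ← map_mul,
    spinGroup.mul_star_self_of_mem s.2, map_one, mul_one]

section

variable (n : ℕ) {G : Type*} [Group G] [FermionParity G]

theorem SpinG.rep_incl_cons (h : SpinG n G) (r : ℝ) (v : Fin n → ℝ) :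
    SpinG.rep (n + 1) G (SpinG.incl n G h) (Fin.cons r v) = Fin.cons r (SpinG.rep n G h v) := by
  have split : ∀ w : Fin n → ℝ, (Fin.cons r w : Fin (n + 1) → ℝ) =
      r • Pi.single 0 1 + (Fin.cons 0 w : Fin (n + 1) → ℝ) := fun w => by
    funext i
    refine Fin.cases ?_ (fun j => ?_) i <;> simp
  induction h using QuotientGroup.induction_on with | _ p => ?_
  change vectorRep (n + 1) (spinIncl n p.1) _ = Fin.cons r (vectorRep n p.1 v)
  rw [split, split, map_add, map_smul, vectorRep_spinIncl_cons, vectorRep_spinIncl_single]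

/-- The class `[1, c]` of an element `c` of `G`. -/
def SpinG.ofRight (c : G) : SpinG n G := QuotientGroup.mk (1, c)

theorem SpinG.rep_ofRight (c : G) : SpinG.rep n G (SpinG.ofRight n c) = 1 :=
  map_one (vectorRep n)

variable [TopologicalSpace G]

theorem SpinG.continuous_incl : Continuous (SpinG.incl n G) :=
  continuous_quot_lift _
    (continuous_quot_mk.comp ((continuous_spinIncl n).prodMap continuous_id))

theorem SpinG.continuous_ofRight_mul (c : G) (hc : Continuous (c * · : G → G)) :
    Continuous (SpinG.ofRight n c * · : SpinG n G → SpinG n G) := by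
  have h : Continuous fun p : Spin n × G => (QuotientGroup.mk (p.1, c * p.2) : SpinG n G) :=
    continuous_quot_mk.comp (continuous_id.prodMap hc)
  rw [(QuotientGroup.isQuotientMap_mk (N := diagonalParity n G)).continuous_iff]
  convert h using 2 with p
  change (QuotientGroup.mk ((1, c) * p) : SpinG n G) = _
  rw [Prod.mul_def, one_mul]

end

section

variable {G G' G'' : Type*} [Group G] [TopologicalSpace G] [FermionParity G]
  [Group G'] [TopologicalSpace G'] [FermionParity G']
  [Group G''] [TopologicalSpace G''] [FermionParity G'']

theorem SpinG.map_map (n : ℕ) (f : ParityHom G G') (k : ParityHom G' G'') (h : SpinG n G) :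
    SpinG.map n k (SpinG.map n f h) = SpinG.map n (k.comp f) h := by
  induction h using QuotientGroup.induction_on
  rfl

theorem SpinG.incl_map_mul_ofRight (n : ℕ) (f g : ParityHom G G') (c : G')
    (hc : ∀ x, f.hom x * c = c * g.hom x) (h : SpinG n G) :
    SpinG.incl n G' (SpinG.map n f h) * SpinG.ofRight (n + 1) c =
      SpinG.ofRight (n + 1) c * SpinG.incl n G' (SpinG.map n g h) := by
  induction h using QuotientGroup.induction_on with | _ p => ?_
  change (QuotientGroup.mk ((spinIncl n p.1, f.hom p.2) * (1, c)) : SpinG (n + 1) G') =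
    QuotientGroup.mk ((1, c) * (spinIncl n p.1, g.hom p.2))
  rw [Prod.mk_mul_mk, Prod.mk_mul_mk, hc, mul_one, one_mul]

theorem SpinStructure.induced_induced {d : ℕ} {E H : Type*} [NormedAddCommGroup E]
    [NormedSpace ℝ E] [TopologicalSpace H] {J : ModelWithCorners ℝ E H} {X : Type u}
    [TopologicalSpace X] [ChartedSpace H X] [IsManifold J ∞ X] (S : SpinStructure d G J X)
    (f : ParityHom G G') (k : ParityHom G' G'') :
    (S.induced f).induced k = S.induced (k.comp f) := by
  simp only [SpinStructure.induced, SpinG.map_map]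

end

/-! ### The unit vector field of the interval -/

/-- The coordinate of the field `∂ₜ` at `t` is the derivative of the preferred chart at `t`, composed
with the projection of `ℝ` onto the interval. -/
theorem one_tangentSpace_apply (t : Icc (0 : ℝ) 1) (a b : ℝ)
    (h : ∀ w ∈ Icc (0 : ℝ) 1,
      (extChartAt (𝓡∂ 1) t (projIcc (0 : ℝ) 1 zero_le_one w)) 0 = a * w + b) :
    (show EuclideanSpace ℝ (Fin 1) from (1 : TangentSpace (𝓡∂ 1) t)) 0 = a := by
  let L : ℝ →L[ℝ] EuclideanSpace ℝ (Fin 1) :=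
    ContinuousLinearMap.toSpanSingleton ℝ (WithLp.toLp 2 fun _ => a)
  have hL : HasFDerivWithinAt
      (fun w => extChartAt (𝓡∂ 1) t (projIcc (0 : ℝ) 1 zero_le_one w)) L (Icc 0 1) t := by
    have h1 : HasFDerivWithinAt (fun w => L w + WithLp.toLp 2 fun _ => b) L (Icc 0 1) (t : ℝ) :=
      L.hasFDerivWithinAt.add_const _
    have h2 : ∀ w ∈ Icc (0 : ℝ) 1, extChartAt (𝓡∂ 1) t (projIcc (0 : ℝ) 1 zero_le_one w) =
        L w + WithLp.toLp 2 fun _ => b := fun w hw => by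
      ext i
      rw [Subsingleton.elim i 0, h w hw]
      simp [L, mul_comm]
    exact h1.congr h2 (h2 t t.2)
  have hp : projIcc (0 : ℝ) 1 zero_le_one t = t := projIcc_val _ _
  have hM : HasMFDerivWithinAt 𝓘(ℝ) (𝓡∂ 1) (projIcc (0 : ℝ) 1 zero_le_one) (Icc 0 1) (t : ℝ) L := by
    refine ⟨continuous_projIcc.continuousWithinAt, ?_⟩
    simpa [writtenInExtChartAt, hp, Function.comp_def] using! hL
  have h2 := hM.mfderivWithin (uniqueDiffOn_Icc zero_lt_one _ t.2).uniqueMDiffWithinAt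
  change (show EuclideanSpace ℝ (Fin 1) from oneTangentSpaceIcc t) 0 = a
  rw [oneTangentSpaceIcc_def]
  have h3 : (mfderivWithin 𝓘(ℝ) (𝓡∂ 1) (projIcc (0 : ℝ) 1 zero_le_one) (Icc 0 1) (t : ℝ) :
      ℝ → EuclideanSpace ℝ (Fin 1)) 1 = L 1 := congrArg (fun T : ℝ →L[ℝ] _ => T 1) h2
  refine (congrArg (fun v : EuclideanSpace ℝ (Fin 1) => v 0) h3).trans ?_
  simp [L]

/-- The field `∂ₜ` has coordinate `1` in the chart at `0`. -/
theorem one_tangentSpace_zero :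
    (show EuclideanSpace ℝ (Fin 1) from
      (1 : TangentSpace (𝓡∂ 1) (0 : Icc (0 : ℝ) 1))) 0 = 1 := by
  refine one_tangentSpace_apply 0 1 0 fun w hw => ?_
  rw [projIcc_of_mem _ hw]
  simp [IccLeftChart]

/-- The field `∂ₜ` has coordinate `-1` in the chart at `1`, which reverses the orientation. -/
theorem one_tangentSpace_one :
    (show EuclideanSpace ℝ (Fin 1) from
      (1 : TangentSpace (𝓡∂ 1) (1 : Icc (0 : ℝ) 1))) 0 = -1 := by
  refine one_tangentSpace_apply 1 (-1) 1 fun w hw => ?_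
  rw [projIcc_of_mem _ hw]
  simp [IccRightChart]
  ring

theorem one_tangentSpace_ne_zero (t : Icc (0 : ℝ) 1) : (1 : TangentSpace (𝓡∂ 1) t) ≠ 0 := by
  intro h
  have h1 := mfderiv_subtypeVal_Icc_one t
  rw [h, map_zero] at h1
  exact zero_ne_one (α := ℝ) h1

theorem continuous_smul_one_tangentSpace (r : ℝ) :
    Continuous fun t : Icc (0 : ℝ) 1 =>
      (⟨t, r • (1 : TangentSpace (𝓡∂ 1) t)⟩ : TangentBundle (𝓡∂ 1) (Icc (0 : ℝ) 1)) := by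
  have h1 : ContinuousOn (tangentMapWithin 𝓘(ℝ) (𝓡∂ 1) (projIcc (0 : ℝ) 1 zero_le_one) (Icc 0 1))
      (Bundle.TotalSpace.proj ⁻¹' Icc 0 1) :=
    (contMDiffOn_projIcc (n := 1)).continuousOn_tangentMapWithin le_rfl
      (uniqueDiffOn_Icc zero_lt_one).uniqueMDiffOn
  have h2 : Continuous fun t : Icc (0 : ℝ) 1 => (⟨t, r⟩ : TangentBundle 𝓘(ℝ) ℝ) :=
    (tangentBundleModelSpaceHomeomorph 𝓘(ℝ)).symm.continuous.comp
      (continuous_subtype_val.prodMk continuous_const)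
  refine (h1.comp_continuous h2 fun t => t.2).congr fun t => ?_
  have h3 : mfderivWithin 𝓘(ℝ) (𝓡∂ 1) (projIcc (0 : ℝ) 1 zero_le_one) (Icc 0 1) t r =
      r • (1 : TangentSpace (𝓡∂ 1) (projIcc (0 : ℝ) 1 zero_le_one t)) := by
    rw [← mfderivWithin_projIcc_one t.2, ← map_smul]
    congr 1
    exact (mul_one r).symm
  change (⟨projIcc (0 : ℝ) 1 zero_le_one t, _⟩ : TangentBundle (𝓡∂ 1) (Icc (0 : ℝ) 1)) = _
  rw [h3, projIcc_val]

/-! ### The cylinder on a Spin-`G` manifold -/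

section

variable {n : ℕ} {G : Type*} [Group G] [TopologicalSpace G] [FermionParity G] {M : Type u}
  [TopologicalSpace M] [ChartedSpace (EuclideanSpace ℝ (Fin n)) M]

/-- The isomorphism `r ↦ r ∂ₜ` from `ℝ` to the tangent space of the interval at `t`. -/
def intervalFrame (t : Icc (0 : ℝ) 1) : ℝ ≃ₗ[ℝ] TangentSpace (𝓡∂ 1) t :=
  let u : EuclideanSpace ℝ (Fin 1) := (1 : TangentSpace (𝓡∂ 1) t)
  (LinearMap.toSpanSingleton ℝ (EuclideanSpace ℝ (Fin 1)) u).linearEquivOfInjective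
    (LinearMap.ker_eq_bot.mp (LinearMap.ker_toSpanSingleton ℝ (one_tangentSpace_ne_zero t)))
    (by simp)

/-- The frame `(∂ₜ, e)` of the cylinder at `(x, t)` given by a frame `e` of `M` at `x`. -/
def cylinderFrame (p : M × Icc (0 : ℝ) 1) (e : (Fin n → ℝ) ≃ₗ[ℝ] TangentSpace (𝓡 n) p.1) :
    (Fin (n + 1) → ℝ) ≃ₗ[ℝ] TangentSpace (halfModel n) p :=
  (Fin.consLinearEquiv ℝ (fun _ : Fin (n + 1) => ℝ)).symm.trans
    ((LinearEquiv.prodComm ℝ ℝ (Fin n → ℝ)).trans (e.prodCongr (intervalFrame p.2)))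

theorem cylinderFrame_cons (p : M × Icc (0 : ℝ) 1)
    (e : (Fin n → ℝ) ≃ₗ[ℝ] TangentSpace (𝓡 n) p.1) (r : ℝ) (v : Fin n → ℝ) :
    cylinderFrame p e (Fin.cons r v) = (e v, r • (1 : TangentSpace (𝓡∂ 1) p.2)) :=
  rfl

variable [IsManifold (𝓡 n) ∞ M]

/-- The structure on `M × [0, 1]` pulled back from `M` and stabilized by the field `∂ₜ`. -/
def cylinder (S : SpinStructure n G (𝓡 n) M) :
    SpinStructure (n + 1) G (halfModel n) (M × Icc (0 : ℝ) 1) where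
  Index := S.Index
  patch a := Prod.fst ⁻¹' S.patch a
  isOpen_patch a := (S.isOpen_patch a).preimage continuous_fst
  cover p := S.cover p.1
  frame a p := cylinderFrame p (S.frame a p.1)
  continuousOn_frame a w := by
    obtain ⟨r, v, rfl⟩ : ∃ r v, w = Fin.cons r v := ⟨w 0, Fin.tail w, (Fin.cons_self_tail w).symm⟩
    have h := (contMDiff_equivTangentBundleProd_symm (n := 0) (I := 𝓡 n) (M := M) (I' := 𝓡∂ 1)
      (M' := Icc (0 : ℝ) 1)).continuous
    exact h.comp_continuousOn
      (((S.continuousOn_frame a v).comp continuous_fst.continuousOn fun _ hp => hp).prodMk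
        ((continuous_smul_one_tangentSpace r).comp continuous_snd).continuousOn)
  trans a b p := SpinG.incl n G (S.trans a b p.1)
  continuousOn_trans a b := (SpinG.continuous_incl n).comp_continuousOn
    ((S.continuousOn_trans a b).comp continuous_fst.continuousOn fun _ hp => hp)
  trans_cocycle a b c p hp := by rw [← map_mul, S.trans_cocycle a b c p.1 hp]
  frame_trans a b p hp w := by
    obtain ⟨r, v, rfl⟩ : ∃ r v, w = Fin.cons r v := ⟨w 0, Fin.tail w, (Fin.cons_self_tail w).symm⟩
    rw [SpinG.rep_incl_cons, cylinderFrame_cons, cylinderFrame_cons, S.frame_trans a b p.1 hp v]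

variable {G' : Type*} [Group G'] [TopologicalSpace G'] [FermionParity G']

/-- An end of the cylinder on the structure induced by `f`, identified with the structure induced by
a homomorphism `g` that is conjugate to `f` by an element `c`. -/
def cylinderEnd (S : SpinStructure n G (𝓡 n) M) (f g : ParityHom G G') (c : G')
    (hc : ∀ x, f.hom x * c = c * g.hom x) (hcont : Continuous (c * · : G' → G'))
    (t : Icc (0 : ℝ) 1) (inward : ℝ)
    (ht : 0 < inward *
      (show EuclideanSpace ℝ (Fin 1) from (1 : TangentSpace (𝓡∂ 1) t)) 0) :
    BoundaryIdentification (S.induced g) (cylinder (S.induced f)) (fun x => (x, t)) inward where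
  compare a α x := SpinG.ofRight (n + 1) c * SpinG.incl n G' (SpinG.map n g (S.trans a α x))
  continuousOn_compare a α := (SpinG.continuous_ofRight_mul (n + 1) c hcont).comp_continuousOn
    ((SpinG.continuous_incl n).comp_continuousOn ((S.induced g).continuousOn_trans a α))
  trans_compare a b α x hα ha hb := by
    change SpinG.incl n G' (SpinG.map n f (S.trans b a x)) * _ = _
    rw [← mul_assoc, SpinG.incl_map_mul_ofRight n f g c hc, mul_assoc, ← map_mul, ← map_mul,
      S.trans_cocycle b a α x ⟨⟨hb, ha⟩, hα⟩]
  compare_trans a α β x hx ha := by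
    change _ * SpinG.incl n G' (SpinG.map n g (S.trans α β x)) = _
    rw [mul_assoc, ← map_mul, ← map_mul, S.trans_cocycle a α β x ⟨⟨ha, hx.1⟩, hx.2⟩]
  frame_tangent a α x hα ha v := by
    rw [map_mul, SpinG.rep_ofRight, one_mul, SpinG.rep_incl_cons, SpinG.rep_map, mfderiv_prod_left]
    refine (cylinderFrame_cons (x, t) (S.frame a x) _ _).trans ?_
    rw [← S.frame_trans a α x ⟨ha, hα⟩ v, zero_smul]
    rfl
  frame_normal a α x hα ha := by
    have h : (Pi.single 0 1 : Fin (n + 1) → ℝ) = Fin.cons 1 0 := by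
      funext i
      refine Fin.cases ?_ (fun j => ?_) i <;> simp
    rw [map_mul, SpinG.rep_ofRight, one_mul, h, SpinG.rep_incl_cons, map_zero]
    have h2 := cylinderFrame_cons (x, t) (S.frame a x) 1 0
    rw [one_smul] at h2
    convert ht using 2
    exact congrArg normalCoord h2

/-- Structures induced by conjugate homomorphisms are bordant. Only multiplication by the
conjugating element has to be continuous. -/
theorem bordant_induced_of_conj [CompactSpace M] [T2Space M] (S : SpinStructure n G (𝓡 n) M)
    (f g : ParityHom G G') (c : G') (hc : ∀ x, f.hom x * c = c * g.hom x)
    (hcont : Continuous (c * · : G' → G')) : Bordant (S.induced f) (S.induced g) :=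
  ⟨{ W := M × Icc (0 : ℝ) 1
     T := cylinder (S.induced f)
     φ₀ := fun x => (x, 0)
     φ₁ := fun x => (x, 1)
     contMDiff₀ := contMDiff_id.prodMk contMDiff_const
     contMDiff₁ := contMDiff_id.prodMk contMDiff_const
     isEmbedding₀ := isEmbedding_prodMkLeft _
     isEmbedding₁ := isEmbedding_prodMkLeft _
     immersion₀ := fun x => by
       rw [mfderiv_prod_left]
       exact LinearMap.inl_injective
     immersion₁ := fun x => by
       rw [mfderiv_prod_left]
       exact LinearMap.inl_injective
     disjoint_range := by
       rw [Set.disjoint_left]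
       rintro _ ⟨x, rfl⟩ ⟨y, hy⟩
       exact zero_ne_one (congrArg Prod.snd hy).symm
     range_union := by
       rw [boundary_product]
       ext ⟨x, t⟩
       simp only [mem_union, mem_range, Prod.mk.injEq, exists_eq_left]
       exact ⟨fun h => ⟨mem_univ _, h.imp Eq.symm Eq.symm⟩, fun h => h.2.imp Eq.symm Eq.symm⟩
     incoming := cylinderEnd S f f 1 (fun x => by rw [mul_one, one_mul])
       (by simpa only [one_mul] using! continuous_id) 0 1 (by rw [one_tangentSpace_zero]; simp)
     outgoing := cylinderEnd S f g c hc hcont 1 (-1) (by rw [one_tangentSpace_one]; simp) }⟩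

end

/-! ### The conjugating element of `GL⁺(2, ℝ)` -/

/-- The sixteenth root of unity `e^{iπ/8}`. -/
def eta : ℂˣ := Units.mk0 (Complex.exp (Real.pi / 8 * Complex.I)) (Complex.exp_ne_zero _)

theorem eta_mul_self : eta * eta = zeta := by
  ext
  have h : Complex.exp ((Real.pi / 4 : ℝ) * Complex.I) = zeta := by
    rw [Complex.exp_mul_I, ← Complex.ofReal_cos, ← Complex.ofReal_sin, Real.cos_pi_div_four,
      Real.sin_pi_div_four]
    have h2 : √2 / 2 = (√2)⁻¹ := by
      rw [div_eq_iff two_ne_zero, eq_inv_mul_iff_mul_eq₀ (by positivity)]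
      exact Real.mul_self_sqrt zero_le_two
    apply Complex.ext <;> simp [zeta, h2]
  change Complex.exp _ * Complex.exp _ = (zeta : ℂ)
  rw [← Complex.exp_add, ← h]
  congr 1
  push_cast
  ring

theorem conjUnits_eta : conjUnits eta = eta⁻¹ := by
  rw [eq_inv_iff_mul_eq_one]
  ext
  change (starRingEnd ℂ) (Complex.exp _) * Complex.exp _ = 1
  rw [← Complex.exp_conj, ← Complex.exp_add, Complex.exp_eq_one_iff]
  exact ⟨0, by simp [map_ofNat]⟩

/-- The rotation of the plane by `π/4`, as multiplication by `ζ = (1 + i)/√2`. -/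
def rotation : GL (Fin 2) ℝ :=
  Matrix.GeneralLinearGroup.mkOfDetNeZero !![(√2)⁻¹, -(√2)⁻¹; (√2)⁻¹, (√2)⁻¹] (by
    rw [Matrix.det_fin_two_of, neg_mul, sub_neg_eq_add, ← two_mul]
    positivity)

/-- The lift `z ↦ e^{iπ/8} z` of the rotation by `π/4`. -/
def hatEta : GLPlusR :=
  ⟨(rotation, Homeomorph.mulLeft eta), fun z => by
    change ((eta : ℂ) * (z : ℂ)) ^ 2 = _
    rw [mul_pow, pow_two (eta : ℂ), ← Units.val_mul, eta_mul_self]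
    apply Complex.ext <;>
      simp [planeAct, rotation, zeta, Matrix.GeneralLinearGroup.mkOfDetNeZero] <;> ring⟩

/-- Since `(A, σ) (B, τ)` evaluates at `1` to `σ (τ 1)`, continuity of left multiplication only
uses that `σ` is continuous. -/
theorem GLPlusR.continuous_mul_left (p : GLPlusR) : Continuous (p * · : GLPlusR → GLPlusR) := by
  have h : Continuous fun q : GLPlusR => (q.1.1, q.1.2 1) := continuous_induced_dom
  exact continuous_induced_rng.mpr
    (((continuous_const_mul p.1.1).comp h.fst).prodMk (p.1.2.continuous.comp h.snd))

theorem GLPlusR.ext' {p q : GLPlusR} (h1 : (p.1.1 : Matrix (Fin 2) (Fin 2) ℝ) = q.1.1)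
    (h2 : ∀ z : ℂˣ, p.1.2 z = q.1.2 z) : p = q :=
  Subtype.ext (Prod.ext (Units.ext h1) (Homeomorph.ext h2))

theorem hatS_mul_hatEta : (hatS : GLPlusR) * hatEta = hatEta * hatS := by
  refine GLPlusR.ext' ?_ fun z => ?_
  · change ((matS : Matrix (Fin 2) (Fin 2) ℤ).map (Int.castRingHom ℝ)) * rotation =
      rotation * ((matS : Matrix (Fin 2) (Fin 2) ℤ).map (Int.castRingHom ℝ))
    ext i j
    fin_cases i <;> fin_cases j <;>
      simp [matS, rotation, Matrix.GeneralLinearGroup.mkOfDetNeZero, Matrix.mul_apply]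
  · exact mul_left_comm zeta eta z

/-- Conjugation by `hatEta` turns the reflection `R̂` by the angle of `Ŝ`. -/
theorem hatEta_mul_hatR :
    hatEta * (hatR : GLPlusR) = (hatS : GLPlusR) * (hatR : GLPlusR) * hatEta := by
  refine GLPlusR.ext' ?_ fun z => ?_
  · change rotation * ((matR : Matrix (Fin 2) (Fin 2) ℤ).map (Int.castRingHom ℝ)) =
      ((matS : Matrix (Fin 2) (Fin 2) ℤ).map (Int.castRingHom ℝ)) *
        ((matR : Matrix (Fin 2) (Fin 2) ℤ).map (Int.castRingHom ℝ)) * rotation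
    ext i j
    fin_cases i <;> fin_cases j <;>
      simp [matS, matR, rotation, Matrix.GeneralLinearGroup.mkOfDetNeZero, Matrix.mul_apply]
  · change eta * (zeta * conjUnits z) = zeta * (zeta * conjUnits (eta * z))
    rw [map_mul, conjUnits_eta, ← eta_mul_self]
    group

theorem dihedralToGL_r_natCast (k : ℕ) :
    dihedralToGL.hom (.r (k : ZMod 8)) = hatS ^ k := by
  have h : (DihedralGroup.r (k : ZMod 8)) = DihedralGroup.r 1 ^ k := by
    rw [DihedralGroup.r_one_pow]
  rw [h, map_pow]
  congr 1
  change hatS ^ ((1 : ZMod 8).cast : ℤ) = hatS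
  rw [show ((1 : ZMod 8).cast : ℤ) = 1 by decide, zpow_one]

theorem dihedralToGL_sr_zero : dihedralToGL.hom (.sr 0) = hatR := by
  change hatR * hatS ^ ((0 : ZMod 8).cast : ℤ) = hatR
  rw [ZMod.cast_zero, zpow_zero, mul_one]

/-- Both homomorphisms `D₈ → GL⁺(2, ℝ)` send `r` to `Ŝ²`, and they send `s` to `R̂` and to `Ŝ R̂`. -/
theorem hatEta_semiconj (x : DihedralGroup 4) :
    SemiconjBy hatEta ((inclusionZR.comp (dihedralToGL.comp embI)).hom x)
      ((inclusionZR.comp (dihedralToGL.comp embITilde)).hom x) := by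
  set f := (inclusionZR.comp (dihedralToGL.comp embI)).hom
  set g := (inclusionZR.comp (dihedralToGL.comp embITilde)).hom
  have hr : SemiconjBy hatEta (f (.r 1)) (g (.r 1)) := by
    change SemiconjBy hatEta (dihedralToGL.hom (embI.hom (.r 1)) : GLPlusR)
      (dihedralToGL.hom (embITilde.hom (.r 1)) : GLPlusR)
    rw [show embI.hom (.r 1) = .r ((2 : ℕ) : ZMod 8) by decide,
      show embITilde.hom (.r 1) = .r ((2 : ℕ) : ZMod 8) by decide, dihedralToGL_r_natCast]
    exact SemiconjBy.pow_right (x := (hatS : GLPlusR)) hatS_mul_hatEta.symm 2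
  have hs : SemiconjBy hatEta (f (.sr 0)) (g (.sr 0)) := by
    change SemiconjBy hatEta (dihedralToGL.hom (embI.hom (.sr 0)) : GLPlusR)
      (dihedralToGL.hom (embITilde.hom (.sr 0)) : GLPlusR)
    rw [show embI.hom (.sr 0) = .sr 0 by decide,
      show embITilde.hom (.sr 0) = .r ((1 : ℕ) : ZMod 8) * .sr 0 by decide, map_mul,
      dihedralToGL_r_natCast, dihedralToGL_sr_zero, pow_one]
    exact hatEta_mul_hatR
  have hrk : ∀ k : ZMod 4, SemiconjBy hatEta (f (.r k)) (g (.r k)) := fun k => by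
    rw [← ZMod.natCast_zmod_val k, ← DihedralGroup.r_one_pow, map_pow, map_pow]
    exact hr.pow_right _
  rcases x with k | k
  · exact hrk k
  · rw [show DihedralGroup.sr k = .sr 0 * .r k by rw [DihedralGroup.sr_mul_r, zero_add], map_mul,
      map_mul]
    exact hs.mul_right (hrk k)

end

end SpinTwist

theorem mainTheorem10 (n : ℕ) (M : Type u) [TopologicalSpace M]
    [ChartedSpace (EuclideanSpace ℝ (Fin n)) M] [IsManifold (𝓡 n) ∞ M]
    [CompactSpace M] [T2Space M]
    (S : SpinTwist.SpinStructure n (DihedralGroup 4) (𝓡 n) M) :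
    SpinTwist.Bordant
      ((S.induced (SpinTwist.dihedralToGL.comp SpinTwist.embI)).induced SpinTwist.inclusionZR)
      ((S.induced (SpinTwist.dihedralToGL.comp SpinTwist.embITilde)).induced
        SpinTwist.inclusionZR) := by
  rw [SpinTwist.SpinStructure.induced_induced, SpinTwist.SpinStructure.induced_induced]
  exact SpinTwist.bordant_induced_of_conj S _ _ SpinTwist.hatEta⁻¹
    (fun x => (SpinTwist.hatEta_semiconj x).inv_symm_left.symm)
    (SpinTwist.GLPlusR.continuous_mul_left _)
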